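/- Let $\mathrm{Nil}$ be the Heisenberg group of real matrices $\begin{pmatrix}1&x&z\\0&1&y\\0&0&1\end{pmatrix}$ with the left-invariant metric $dx^2+dy^2+(dz-x\,dy)^2$, its Levi-Civita connection $\nabla$, and the positively oriented left-invariant orthonormal frame $e_1=\partial_x$, $e_2=\partial_y+x\,\partial_z$, $e_3=\partial_z$. Let $M$ be a connected Riemann surface and $f:M\to\mathrm{Nil}$ a smooth conformal immersion. For a local complex parameter $\zeta=s+it$ on $M$, let $f^{-1}\partial_\zeta f=Z_1e_1+Z_2e_2+Z_3e_3$, where $\partial_\zeta=\tfrac12(\partial_s-i\partial_t)$, let $N$ be the unit normal such that $(f_s,f_t,N)$ is positively oriented, let $H$ be the mean curvature with respect to $N$ (half of the trace of the second fundamental form $\langle\nabla_{f_u}f_v,N\rangle$, $u,v\in\{s,t\}$), and let $A=\langle\nabla_{f_\zeta}f_\zeta,N\rangle$ be the coefficient of the Hopf differential, where the metric and the connection are extended complex-bilinearly. If the quadratic differential $$\widetilde A\,d\zeta^2=\Big(A+\frac{Z_3^2}{2H+i}\Big)d\zeta^2$$ is holomorphic, that is, if its coefficient $\widetilde A$ in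 every local complex parameter is a holomorphic function, then $H$ is constant on $M$. -/

import Mathlib

open scoped Manifold ContDiff Matrix

namespace NilGeometry

noncomputable section

/-- The Heisenberg group `Nil`: `⟨x, y, z⟩` stands for the upper triangular matrix
`!![1, x, z; 0, 1, y; 0, 0, 1]`. -/
@[ext] structure Nil where
  x : ℝ
  y : ℝ
  z : ℝ

namespace Nil

/-- The matrix that an element of `Nil` stands for. -/
def toMatrix (g : Nil) : Matrix (Fin 3) (Fin 3) ℝ :=
  !![1, g.x, g.z; 0, 1, g.y; 0, 0, 1]

/-- The global coordinates `(x, y, z)`, which give `Nil` its smooth structure. -/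
def coords (g : Nil) : Fin 3 → ℝ := ![g.x, g.y, g.z]

instance : One Nil := ⟨⟨0, 0, 0⟩⟩
instance : Mul Nil := ⟨fun g h => ⟨g.x + h.x, g.y + h.y, g.z + h.z + g.x * h.y⟩⟩
instance : Inv Nil := ⟨fun g => ⟨-g.x, -g.y, -g.z + g.x * g.y⟩⟩

@[simp] theorem one_x : (1 : Nil).x = 0 := rfl
@[simp] theorem one_y : (1 : Nil).y = 0 := rfl
@[simp] theorem one_z : (1 : Nil).z = 0 := rfl
@[simp] theorem mul_x (g h : Nil) : (g * h).x = g.x + h.x := rfl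
@[simp] theorem mul_y (g h : Nil) : (g * h).y = g.y + h.y := rfl
@[simp] theorem mul_z (g h : Nil) : (g * h).z = g.z + h.z + g.x * h.y := rfl
@[simp] theorem inv_x (g : Nil) : (g⁻¹).x = -g.x := rfl
@[simp] theorem inv_y (g : Nil) : (g⁻¹).y = -g.y := rfl
@[simp] theorem inv_z (g : Nil) : (g⁻¹).z = -g.z + g.x * g.y := rfl

instance : Group Nil where
  mul_assoc a b c := by ext <;> simp <;> ring
  one_mul a := by ext <;> simp
  mul_one a := by ext <;> simp
  inv_mul_cancel a := by ext <;> simp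

/-- The group law of `Nil` is matrix multiplication. -/
theorem toMatrix_mul (g h : Nil) : (g * h).toMatrix = g.toMatrix * h.toMatrix := by
  ext i j
  fin_cases i <;> fin_cases j <;> simp [toMatrix, Matrix.mul_apply, Fin.sum_univ_three] <;> ring

theorem toMatrix_one : (1 : Nil).toMatrix = 1 := by
  ext i j
  fin_cases i <;> fin_cases j <;> simp [toMatrix]

end Nil

/-- The basis `e₁, e₂, e₃` (indexed by `0, 1, 2`) of the Lie algebra of `Nil`. -/
def basisVec : Fin 3 → Matrix (Fin 3) (Fin 3) ℝ :=
  ![!![0, 1, 0; 0, 0, 0; 0, 0, 0], !![0, 0, 0; 0, 0, 1; 0, 0, 0], !![0, 0, 1; 0, 0, 0; 0, 0, 0]]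

/-- The coordinates, with respect to `e₁, e₂, e₃`, of an element of the Lie algebra of `Nil`. The
inner product on the Lie algebra is the one that makes `e₁, e₂, e₃` orthonormal, so it is the dot
product of these coordinates. -/
def lieCoord (X : Matrix (Fin 3) (Fin 3) ℝ) : Fin 3 → ℝ := ![X 0 1, X 1 2, X 0 2]

/-- `α i j k = ⟨[e_i, e_j], e_k⟩`. -/
def structConst (i j k : Fin 3) : ℝ := lieCoord ⁅basisVec i, basisVec j⁆ k

/-- `nabla j k i` is the `e_i`-component of `∇_{e_j} e_k`, for the Levi-Civita connection `∇` of the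
left-invariant metric in which `e₁, e₂, e₃` is an orthonormal frame (Koszul's formula). -/
def nabla (j k i : Fin 3) : ℝ :=
  (structConst j k i + structConst i j k + structConst i k j) / 2

/-- The connection has no torsion. -/
theorem nabla_torsion_free (j k i : Fin 3) : nabla j k i - nabla k j i = structConst j k i := by
  fin_cases i <;> fin_cases j <;> fin_cases k <;>
    simp [nabla, structConst, lieCoord, basisVec, Ring.lie_def] <;> norm_num

/-- The connection is compatible with the metric. -/
theorem nabla_metric (j k i : Fin 3) : nabla j k i + nabla j i k = 0 := by
  fin_cases i <;> fin_cases j <;> fin_cases k <;>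
    simp [nabla, structConst, lieCoord, basisVec, Ring.lie_def] <;> norm_num

/-- For a map `F` from (an open subset of) the plane to `Nil`, the partial derivative of `F` at `w`
in the direction `v`, as a matrix. -/
def partialDeriv (F : ℂ → Nil) (v w : ℂ) : Matrix (Fin 3) (Fin 3) ℝ :=
  Matrix.of fun i j => fderiv ℝ (fun u => (F u).toMatrix i j) w v

/-- The left translation `F⁻¹ (∂_v F)` to the Lie algebra, in the basis `e₁, e₂, e₃`; equivalently,
the components of `∂_v F` in the left-invariant orthonormal frame. -/
def vel (F : ℂ → Nil) (v w : ℂ) : Fin 3 → ℝ :=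
  lieCoord ((F w)⁻¹.toMatrix * partialDeriv F v w)

/-- In coordinates, `vel` is given by the coframe `dx, dy, dz - x dy`; in particular the induced
left-invariant metric is `dx² + dy² + (dz - x dy)²`. -/
theorem vel_eq (F : ℂ → Nil) (v w : ℂ) :
    vel F v w = ![fderiv ℝ (fun u => (F u).x) w v, fderiv ℝ (fun u => (F u).y) w v,
      fderiv ℝ (fun u => (F u).z) w v - (F w).x * fderiv ℝ (fun u => (F u).y) w v] := by
  ext i
  fin_cases i <;>
    simp [vel, lieCoord, partialDeriv, Nil.toMatrix, Matrix.mul_apply, Fin.sum_univ_three] <;> ring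

/-- The covariant derivative `∇_{∂_v F} W` of a vector field `W` along `F`; vector fields along `F`
are written in the left-invariant frame. -/
def covDeriv (F : ℂ → Nil) (v : ℂ) (W : ℂ → Fin 3 → ℝ) (w : ℂ) : Fin 3 → ℝ := fun i =>
  fderiv ℝ (fun u => W u i) w v + ∑ j, ∑ k, vel F v w j * W w k * nabla j k i

/-- The unit normal `N` for which `(∂_x F, ∂_y F, N)` is positively oriented, where
`(e₁, e₂, e₃)` is positive. -/
def normal (F : ℂ → Nil) (w : ℂ) : Fin 3 → ℝ :=
  let n := crossProduct (vel F 1 w) (vel F Complex.I w)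
  (Real.sqrt (n ⬝ᵥ n))⁻¹ • n

/-- The first fundamental form `⟨∂_u F, ∂_v F⟩` of a parametrized surface `F`. -/
def firstForm (F : ℂ → Nil) (u v w : ℂ) : ℝ := vel F u w ⬝ᵥ vel F v w

/-- The second fundamental form `⟨∇_{∂_u F} ∂_v F, N⟩` of a parametrized surface `F`. -/
def secondForm (F : ℂ → Nil) (u v w : ℂ) : ℝ := covDeriv F u (vel F v) w ⬝ᵥ normal F w

/-- The mean curvature of a parametrized surface `F` at the parameter `w`: half of the trace of the
second fundamental form with respect to the first one. -/
def meanCurv (F : ℂ → Nil) (w : ℂ) : ℝ :=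
  (firstForm F Complex.I Complex.I w * secondForm F 1 1 w
      - 2 * firstForm F 1 Complex.I w * secondForm F 1 Complex.I w
      + firstForm F 1 1 w * secondForm F Complex.I Complex.I w)
    / (2 * (firstForm F 1 1 w * firstForm F Complex.I Complex.I w - firstForm F 1 Complex.I w ^ 2))

/-- The Wirtinger derivative `∂ = (∂_x - i ∂_y) / 2`. -/
def wirtinger (g : ℂ → ℂ) (w : ℂ) : ℂ :=
  (fderiv ℝ g w 1 - Complex.I * fderiv ℝ g w Complex.I) / 2

/-- The components `Z₁, Z₂, Z₃` (indexed by `0, 1, 2`) of `F⁻¹ ∂F`. -/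
def Z (F : ℂ → Nil) (k : Fin 3) (w : ℂ) : ℂ :=
  ((vel F 1 w k : ℂ) - Complex.I * (vel F Complex.I w k : ℂ)) / 2

/-- The coefficient `A = ⟨∇_{∂F} ∂F, N⟩` of the Hopf differential `A dz²`; the connection and the
metric are extended complex-(bi)linearly. -/
def hopfCoeff (F : ℂ → Nil) (w : ℂ) : ℂ :=
  ∑ i, (wirtinger (Z F i) w + ∑ j, ∑ k, Z F j w * Z F k w * (nabla j k i : ℂ)) *
    (normal F w i : ℂ)

/-- The coefficient `A + Z₃² / (2H + i)` of the modified Hopf differential. -/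
def modifiedHopfCoeff (F : ℂ → Nil) (w : ℂ) : ℂ :=
  hopfCoeff F w + Z F 2 w ^ 2 / (2 * (meanCurv F w : ℂ) + Complex.I)

section Surface

variable {M : Type*} [TopologicalSpace M] [ChartedSpace ℂ M]

/-- `f` in the local complex parameter `e`. Only its values on `e.target` matter. -/
def inChart (f : M → Nil) (e : OpenPartialHomeomorph M ℂ) : ℂ → Nil := fun w => f (e.symm w)

/-- `f` is a smooth conformal immersion of the Riemann surface `M` into `Nil`: in each local complex
parameter `z` the induced metric has the form `e^{2α} dz dz̄`. -/
structure IsConformalImmersion (f : M → Nil) : Prop where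
  smooth : ContMDiff 𝓘(ℝ, ℂ) 𝓘(ℝ, Fin 3 → ℝ) ∞ (fun p => (f p).coords)
  pos : ∀ e ∈ atlas ℂ M, ∀ w ∈ e.target, 0 < firstForm (inChart f e) 1 1 w
  eq : ∀ e ∈ atlas ℂ M, ∀ w ∈ e.target,
    firstForm (inChart f e) Complex.I Complex.I w = firstForm (inChart f e) 1 1 w
  orthogonal : ∀ e ∈ atlas ℂ M, ∀ w ∈ e.target, firstForm (inChart f e) 1 Complex.I w = 0

/-- The mean curvature of the surface `f` at the point `p`. -/
def meanCurvature (f : M → Nil) (p : M) : ℝ :=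
  meanCurv (inChart f (chartAt ℂ p)) (chartAt ℂ p p)

/-- The quadratic differential `(A + Z₃² / (2H + i)) dz²` is holomorphic: in each local complex
parameter its coefficient is a holomorphic function. -/
def ModifiedHopfHolomorphic (f : M → Nil) : Prop :=
  ∀ e ∈ atlas ℂ M, DifferentiableOn ℂ (modifiedHopfCoeff (inChart f e)) e.target

end Surface

end

end NilGeometry

/-!
Write `Z = F⁻¹ ∂F`, let `λ` be the conformal factor and `N₃` the vertical component of the unit
normal. The equation `∇_{∂̄} Z = (λ H / 2) N` and the Codazzi equation, in which the curvature of
`Nil` contributes `-λ N₃ Z₃ / 2`, read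
`∂̄Z₃ = λ N₃ (2H + i) / 4` and `∂̄A = (λ / 2) (∂H - N₃ Z₃)`. In the derivative of
`Ã = A + Z₃² / (2H + i)` the terms with `N₃` cancel:
`∂̄Ã = (λ / 2) ∂H - 2 Z₃² ∂̄H / (2H + i)²`.
If `Ã` is holomorphic, taking norms gives `λ (4H² + 1) |∂H| = 4 |Z₃|² |∂H| = λ (1 - N₃²) |∂H|`,
since `H` is real. Hence `H = 0` wherever `dH ≠ 0`; as this set is open, it is empty.
-/

namespace NilGeometry

open Complex (I)
open Filter Topology

noncomputable section

section WirtingerOp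

theorem map_eq_re_smul_add_im_smul {E : Type*} [AddCommGroup E] [Module ℝ E] [TopologicalSpace E]
    (L : ℂ →L[ℝ] E) (z : ℂ) : L z = z.re • L 1 + z.im • L I := by
  rw [← map_smul, ← map_smul, ← map_add]
  congr 1
  simp [Complex.re_add_im]

variable {E : Type*} [NormedAddCommGroup E] [NormedSpace ℂ E]

/-- The operator `(∂_s + c ∂_t) / 2` in the plane with coordinate `s + i t`. The choices `c = -i`
and `c = i` give the Wirtinger derivatives `∂` and `∂̄`; keeping `c` free treats both at once. -/
def wirtingerOp (c : ℂ) (g : ℂ → E) (w : ℂ) : E :=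
  (2⁻¹ : ℂ) • (fderiv ℝ g w 1 + c • fderiv ℝ g w I)

local notation:max "∂[" c "]" => wirtingerOp c

variable {F G : Type*} [NormedAddCommGroup F] [NormedSpace ℂ F] [NormedAddCommGroup G]
  [NormedSpace ℂ G] {c d w : ℂ}

theorem wirtinger_eq_wirtingerOp (g : ℂ → ℂ) : wirtinger g = ∂[-I] g := by
  funext w
  simp only [wirtinger, wirtingerOp, smul_eq_mul]
  ring

theorem wirtingerOp_congr {g h : ℂ → E} (e : g =ᶠ[𝓝 w] h) : ∂[c] g w = ∂[c] h w := by
  simp only [wirtingerOp, e.fderiv_eq]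

theorem wirtingerOp_const (a : E) : ∂[c] (fun _ => a) w = 0 := by
  simp [wirtingerOp]

theorem wirtingerOp_add {g h : ℂ → E} (hg : DifferentiableAt ℝ g w)
    (hh : DifferentiableAt ℝ h w) : ∂[c] (fun u => g u + h u) w = ∂[c] g w + ∂[c] h w := by
  simp only [wirtingerOp, fderiv_fun_add hg hh, add_apply]
  module

theorem wirtingerOp_linear (L : E →L[ℂ] F) {g : ℂ → E} (hg : DifferentiableAt ℝ g w) :
    ∂[c] (fun u => L (g u)) w = L (∂[c] g w) := by
  have hfd := ((L.restrictScalars ℝ).hasFDerivAt.comp w hg.hasFDerivAt).fderiv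
  simp only [Function.comp_def, ContinuousLinearMap.coe_restrictScalars'] at hfd
  simp [wirtingerOp, hfd]

theorem wirtingerOp_bilinear [FiniteDimensional ℂ E] [FiniteDimensional ℂ F]
    (B : E →ₗ[ℂ] F →ₗ[ℂ] G) {g : ℂ → E} {h : ℂ → F} (hg : DifferentiableAt ℝ g w)
    (hh : DifferentiableAt ℝ h w) :
    ∂[c] (fun u => B (g u) (h u)) w = B (∂[c] g w) (h w) + B (g w) (∂[c] h w) := by
  have hfd (v : ℂ) : fderiv ℝ (fun u => B (g u) (h u)) w v =
      B (fderiv ℝ g w v) (h w) + B (g w) (fderiv ℝ h w v) := by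
    have hB := (B.toContinuousBilinearMap.bilinearRestrictScalars ℝ).fderiv_of_bilinear hg hh
    simp only [ContinuousLinearMap.bilinearRestrictScalars_apply_apply,
      LinearMap.toContinuousBilinearMap_apply] at hB
    simp [hB, add_comm]
  simp only [wirtingerOp, hfd, map_add, map_smul, LinearMap.add_apply, LinearMap.smul_apply]
  module

theorem contDiffAt_ofReal {n : ℕ∞ω} {g : ℂ → ℝ} (hg : ContDiffAt ℝ n g w) :
    ContDiffAt ℝ n (fun u => (g u : ℂ)) w :=
  Complex.ofRealCLM.contDiff.contDiffAt.comp w hg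

theorem contDiffAt_bilinear [FiniteDimensional ℂ E] [FiniteDimensional ℂ F]
    (B : E →ₗ[ℂ] F →ₗ[ℂ] G) {n : ℕ∞ω} {g : ℂ → E} {h : ℂ → F} (hg : ContDiffAt ℝ n g w)
    (hh : ContDiffAt ℝ n h w) : ContDiffAt ℝ n (fun u => B (g u) (h u)) w := by
  let B' := B.toContinuousBilinearMap.bilinearRestrictScalars ℝ
  exact (B'.contDiff.contDiffAt.comp w hg).clm_apply hh

theorem wirtingerOp_smul [FiniteDimensional ℂ E] {g : ℂ → ℂ} {h : ℂ → E}
    (hg : DifferentiableAt ℝ g w) (hh : DifferentiableAt ℝ h w) :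
    ∂[c] (fun u => g u • h u) w = ∂[c] g w • h w + g w • ∂[c] h w :=
  wirtingerOp_bilinear (LinearMap.lsmul ℂ E) hg hh

theorem wirtingerOp_mul {g h : ℂ → ℂ} (hg : DifferentiableAt ℝ g w)
    (hh : DifferentiableAt ℝ h w) :
    ∂[c] (fun u => g u * h u) w = ∂[c] g w * h w + g w * ∂[c] h w :=
  wirtingerOp_smul hg hh

theorem wirtingerOp_div {g h : ℂ → ℂ} (hg : DifferentiableAt ℝ g w)
    (hh : DifferentiableAt ℝ h w) (hw : h w ≠ 0) :
    ∂[c] (fun u => g u / h u) w = (∂[c] g w * h w - g w * ∂[c] h w) / h w ^ 2 := by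
  have hmul : (fun u => g u * (h u)⁻¹ * h u) =ᶠ[𝓝 w] g := by
    filter_upwards [hh.continuousAt.eventually_ne hw] with u hu using inv_mul_cancel_right₀ hu _
  have product := wirtingerOp_mul (c := c) (hg.fun_mul (hh.fun_inv hw)) hh
  rw [wirtingerOp_congr hmul] at product
  simp only [div_eq_mul_inv, product]
  field_simp
  ring

theorem wirtingerOp_ofReal {g : ℂ → ℝ} (hg : DifferentiableAt ℝ g w) :
    ∂[c] (fun u => (g u : ℂ)) w = (fderiv ℝ g w 1 + c * fderiv ℝ g w I) / 2 := by
  have hfd := (Complex.ofRealCLM.hasFDerivAt.comp w hg.hasFDerivAt).fderiv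
  simp only [Function.comp_def, Complex.ofRealCLM_apply] at hfd
  simp only [wirtingerOp, hfd, ContinuousLinearMap.comp_apply, Complex.ofRealCLM_apply,
    smul_eq_mul]
  ring

theorem wirtingerOp_apply {ι : Type*} [Fintype ι] {g : ℂ → ι → ℂ}
    (hg : DifferentiableAt ℝ g w) (i : ι) : ∂[c] g w i = ∂[c] (fun u => g u i) w :=
  (wirtingerOp_linear (ContinuousLinearMap.proj i) hg).symm

theorem contDiffAt_wirtingerOp {m n : ℕ∞ω} {g : ℂ → E} (hg : ContDiffAt ℝ n g w)
    (hmn : m + 1 ≤ n) : ContDiffAt ℝ m (∂[c] g) w := by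
  have hfd : ContDiffAt ℝ m (fderiv ℝ g) w := hg.fderiv_right hmn
  unfold wirtingerOp
  fun_prop

theorem wirtingerOp_comm {g : ℂ → E} (hg : ContDiffAt ℝ 2 g w) :
    ∂[c] (∂[d] g) w = ∂[d] (∂[c] g) w := by
  have hfd : DifferentiableAt ℝ (fderiv ℝ g) w :=
    (hg.fderiv_right (m := 1) (by norm_num)).differentiableAt one_ne_zero
  have snd (a v : ℂ) : fderiv ℝ (∂[a] g) w v =
      (2⁻¹ : ℂ) • (fderiv ℝ (fderiv ℝ g) w v 1 + a • fderiv ℝ (fderiv ℝ g) w v I) := by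
    have h1 := hfd.hasFDerivAt.clm_apply (hasFDerivAt_const (1 : ℂ) w)
    have hI := hfd.hasFDerivAt.clm_apply (hasFDerivAt_const I w)
    have hfd2 : HasFDerivAt (∂[a] g) _ w := (h1.add (hI.const_smul a)).const_smul (2⁻¹ : ℂ)
    simp [hfd2.fderiv]
  have symm : fderiv ℝ (fderiv ℝ g) w 1 I = fderiv ℝ (fderiv ℝ g) w I 1 :=
    (hg.isSymmSndFDerivAt (by simp)).eq _ _
  rw [wirtingerOp, wirtingerOp]
  simp only [snd, symm]
  module

theorem wirtingerOp_I_eq_zero {g : ℂ → E} (hg : DifferentiableAt ℂ g w) : ∂[I] g w = 0 := by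
  have hI : fderiv ℂ g w I = I • fderiv ℂ g w 1 := by rw [← map_smul, smul_eq_mul, mul_one]
  simp [wirtingerOp, hg.fderiv_restrictScalars ℝ, hI, smul_smul]

theorem wirtingerOp_comp_holomorphic (hc : c * c = -1) {φ : ℂ → ℂ} {g : ℂ → E}
    (hφ : DifferentiableAt ℂ φ w) (hg : DifferentiableAt ℝ g (φ w)) :
    ∂[c] (fun u => g (φ u)) w =
      ((deriv φ w).re - c * (deriv φ w).im : ℂ) • ∂[c] g (φ w) := by
  have chain (v : ℂ) : fderiv ℝ (fun u => g (φ u)) w v = fderiv ℝ g (φ w) (v * deriv φ w) := by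
    have hfd := (hg.hasFDerivAt.comp w (hφ.hasDerivAt.hasFDerivAt.restrictScalars ℝ)).fderiv
    simp only [Function.comp_def] at hfd
    simp [hfd]
  rw [wirtingerOp, chain, chain, map_eq_re_smul_add_im_smul,
    map_eq_re_smul_add_im_smul _ (I * _)]
  simp only [← Complex.coe_smul, one_mul, Complex.mul_re, Complex.mul_im, Complex.I_re,
    Complex.I_im, wirtingerOp]
  push_cast
  match_scalars
  · ring
  · linear_combination ((deriv φ w).im / 2 : ℂ) * hc

theorem norm_wirtingerOp_I_ofReal {g : ℂ → ℝ} (hg : DifferentiableAt ℝ g w) :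
    ‖∂[I] (fun u => (g u : ℂ)) w‖ = ‖∂[-I] (fun u => (g u : ℂ)) w‖ := by
  rw [← Complex.norm_conj, wirtingerOp_ofReal hg, wirtingerOp_ofReal hg]
  simp

theorem fderiv_eq_zero_of_wirtingerOp_ofReal {g : ℂ → ℝ} (hg : DifferentiableAt ℝ g w)
    (h : ∂[-I] (fun u => (g u : ℂ)) w = 0) : fderiv ℝ g w = 0 := by
  rw [wirtingerOp_ofReal hg] at h
  have h1 : fderiv ℝ g w 1 = 0 := by simpa using congrArg Complex.re h
  have hI : fderiv ℝ g w I = 0 := by simpa using congrArg Complex.im h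
  ext v
  rw [map_eq_re_smul_add_im_smul, h1, hI]
  simp

end WirtingerOp

section LeviCivita

/-- The complex-bilinear extension of `(X, Y) ↦ ∇_X Y` to left-invariant vector fields. Because `∇`
is metric, each `∇_X` is the cross product with an axial vector, which depends linearly on `X`. -/
def leviCivita : (Fin 3 → ℂ) →ₗ[ℂ] (Fin 3 → ℂ) →ₗ[ℂ] (Fin 3 → ℂ) :=
  crossProduct ∘ₗ Matrix.mulVecLin (Matrix.diagonal ![2⁻¹, 2⁻¹, -2⁻¹])

theorem leviCivita_apply (X Y : Fin 3 → ℂ) :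
    leviCivita X Y = ![X 0 / 2, X 1 / 2, -X 2 / 2] ⨯₃ Y := by
  have axial : Matrix.diagonal ![(2⁻¹ : ℂ), 2⁻¹, -2⁻¹] *ᵥ X = ![X 0 / 2, X 1 / 2, -X 2 / 2] := by
    ext i
    fin_cases i <;> simp [Matrix.mulVec_diagonal] <;> ring
  simp [leviCivita, axial]

theorem sum_nabla_eq_leviCivita (X Y : Fin 3 → ℂ) (i : Fin 3) :
    ∑ j, ∑ k, X j * Y k * (nabla j k i : ℂ) = leviCivita X Y i := by
  rw [leviCivita_apply]
  fin_cases i <;>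
    simp [Fin.sum_univ_three, nabla, structConst, lieCoord, basisVec, Ring.lie_def,
      cross_apply] <;> ring

theorem leviCivita_dotProduct_add (X Y W : Fin 3 → ℂ) :
    leviCivita X Y ⬝ᵥ W + Y ⬝ᵥ leviCivita X W = 0 := by
  simp only [leviCivita_apply]
  rw [dotProduct_comm, triple_product_permutation, triple_product_permutation,
    ← cross_anticomm W, dotProduct_neg, add_neg_cancel]

theorem leviCivita_sub_swap (X Y : Fin 3 → ℂ) :
    leviCivita X Y - leviCivita Y X = ![0, 0, (X ⨯₃ Y) 2] := by
  simp only [leviCivita_apply]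
  ext i
  fin_cases i <;> simp [cross_apply] <;> ring

theorem leviCivita_curvature (X Y W : Fin 3 → ℂ) :
    leviCivita X (leviCivita Y W) - leviCivita Y (leviCivita X W)
      - leviCivita (leviCivita X Y - leviCivita Y X) W
      = (![0, 0, (X ⨯₃ Y) 2] - (4⁻¹ : ℂ) • (X ⨯₃ Y)) ⨯₃ W := by
  simp only [leviCivita_apply]
  ext i
  fin_cases i <;> simp [cross_apply] <;> ring

end LeviCivita

local notation:max "∂[" c "]" => wirtingerOp c

theorem eq_of_dotProduct_eq_of_cross {R : Type*} [CommRing R] [IsDomain R] {p q v w : Fin 3 → R}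
    (h : p ⨯₃ q ⬝ᵥ p ⨯₃ q ≠ 0) (hp : p ⬝ᵥ v = p ⬝ᵥ w) (hq : q ⬝ᵥ v = q ⬝ᵥ w)
    (hpq : p ⨯₃ q ⬝ᵥ v = p ⨯₃ q ⬝ᵥ w) : v = w := by
  rw [← sub_eq_zero] at hp hq hpq ⊢
  rw [← dotProduct_sub] at hp hq hpq
  rw [triple_product_eq_det] at h
  refine Matrix.eq_zero_of_mulVec_eq_zero h ?_
  ext i
  fin_cases i <;> assumption

section CovariantDerivative

/-- `F⁻¹ ∂_c F` for `∂_c = (∂_s + c ∂_t) / 2`, in the complexified frame `e₁, e₂, e₃`: this is `Z`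
for `c = -i` and its conjugate for `c = i`. -/
def complexVel (F : ℂ → Nil) (c w : ℂ) : Fin 3 → ℂ :=
  fun k => (vel F 1 w k + c * vel F I w k) / 2

/-- The coordinates `(x, y, z)` of `F`, regarded as complex numbers. -/
def complexCoords (F : ℂ → Nil) (u : ℂ) : Fin 3 → ℂ := fun k => (F u).coords k

/-- The covariant derivative `∇_{∂_c F} W` with `∂_c = (∂_s + c ∂_t) / 2` of a complexified vector
field `W` along `F`. -/
def complexCovDeriv (F : ℂ → Nil) (c : ℂ) (W : ℂ → Fin 3 → ℂ) (w : ℂ) : Fin 3 → ℂ :=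
  ∂[c] W w + leviCivita (complexVel F c w) (W w)

local notation:max "∇[" F ", " c "]" => complexCovDeriv F c

variable {F : ℂ → Nil} {c d w : ℂ} {V W : ℂ → Fin 3 → ℂ}

theorem complexVel_neg_I (F : ℂ → Nil) (w : ℂ) : complexVel F (-I) w = fun k => Z F k w := by
  funext k
  simp only [complexVel, Z]
  ring

theorem contDiffAt_vel {m n : ℕ∞ω} (hF : ContDiffAt ℝ n (fun u => (F u).coords) w)
    (hmn : m + 1 ≤ n) (v : ℂ) : ContDiffAt ℝ m (vel F v) w := by
  have hcoord := contDiffAt_pi.mp hF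
  have hderiv (k : Fin 3) : ContDiffAt ℝ m (fun u => fderiv ℝ (fun t => (F t).coords k) u v) w :=
    ((hcoord k).fderiv_right hmn).clm_apply contDiffAt_const
  have hx : ContDiffAt ℝ m (fun u => (F u).x) w := (hcoord 0).of_le (le_self_add.trans hmn)
  simp only [funext (vel_eq F v)]
  refine contDiffAt_pi.mpr fun k => ?_
  fin_cases k
  · exact hderiv 0
  · exact hderiv 1
  · exact (hderiv 2).sub (hx.mul (hderiv 1))

theorem contDiffAt_complexVel {m n : ℕ∞ω} (hF : ContDiffAt ℝ n (fun u => (F u).coords) w)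
    (hmn : m + 1 ≤ n) : ContDiffAt ℝ m (complexVel F c) w := by
  have hvel (v : ℂ) (k : Fin 3) : ContDiffAt ℝ m (fun u => (vel F v u k : ℂ)) w :=
    contDiffAt_ofReal (contDiffAt_pi.mp (contDiffAt_vel hF hmn v) k)
  unfold complexVel
  fun_prop

theorem contDiffAt_complexCoords {n : ℕ∞ω} (hF : ContDiffAt ℝ n (fun u => (F u).coords) w) :
    ContDiffAt ℝ n (complexCoords F) w :=
  contDiffAt_pi.mpr fun k => contDiffAt_ofReal (contDiffAt_pi.mp hF k)

theorem differentiableAt_complexCoords (hF : DifferentiableAt ℝ (fun u => (F u).coords) w) :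
    DifferentiableAt ℝ (complexCoords F) w :=
  differentiableAt_pi.mpr fun k =>
    Complex.ofRealCLM.differentiableAt.comp w (differentiableAt_pi.mp hF k)

theorem complexVel_eq_wirtingerOp (hF : DifferentiableAt ℝ (fun u => (F u).coords) w) :
    complexVel F c w = ∂[c] (complexCoords F) w +
      (complexCoords F w 0 * ∂[c] (complexCoords F) w 1) • ![0, 0, -1] := by
  have hderiv (k : Fin 3) : ∂[c] (complexCoords F) w k =
      (fderiv ℝ (fun u => (F u).coords k) w 1 +
        c * fderiv ℝ (fun u => (F u).coords k) w I) / 2 := by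
    rw [wirtingerOp_apply (differentiableAt_complexCoords hF)]
    exact wirtingerOp_ofReal (differentiableAt_pi.mp hF k)
  ext k
  simp only [Pi.add_apply, Pi.smul_apply, hderiv]
  fin_cases k <;> simp [complexVel, complexCoords, Nil.coords, vel_eq]
  ring

theorem complexVel_eventuallyEq (hF : ContDiffAt ℝ 1 (fun u => (F u).coords) w) :
    complexVel F c =ᶠ[𝓝 w] fun u => ∂[c] (complexCoords F) u +
      (complexCoords F u 0 * ∂[c] (complexCoords F) u 1) • ![0, 0, -1] := by
  filter_upwards [hF.eventually (by simp)] with u hu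
  exact complexVel_eq_wirtingerOp (hu.differentiableAt one_ne_zero)

theorem contDiffAt_complexCovDeriv {m n : ℕ∞ω}
    (hF : ContDiffAt ℝ n (fun u => (F u).coords) w) (hW : ContDiffAt ℝ n W w) (hmn : m + 1 ≤ n) :
    ContDiffAt ℝ m (∇[F, c] W) w :=
  (contDiffAt_wirtingerOp hW hmn).add (contDiffAt_bilinear leviCivita
    (contDiffAt_complexVel hF hmn) (hW.of_le (le_self_add.trans hmn)))

theorem complexCovDeriv_congr (e : V =ᶠ[𝓝 w] W) : ∇[F, c] V w = ∇[F, c] W w := by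
  rw [complexCovDeriv, complexCovDeriv, wirtingerOp_congr e, e.eq_of_nhds]

theorem wirtingerOp_dotProduct (hV : DifferentiableAt ℝ V w) (hW : DifferentiableAt ℝ W w) :
    ∂[c] (fun u => V u ⬝ᵥ W u) w = ∇[F, c] V w ⬝ᵥ W w + V w ⬝ᵥ ∇[F, c] W w := by
  have product := wirtingerOp_bilinear (c := c) (dotProductBilin ℂ ℂ) hV hW
  simp only [dotProductBilin_apply_apply] at product
  rw [product, complexCovDeriv, complexCovDeriv, add_dotProduct, dotProduct_add]
  linear_combination -leviCivita_dotProduct_add (complexVel F c w) (V w) (W w)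

theorem complexCovDeriv_dotProduct_add_eq_zero (hV : DifferentiableAt ℝ V w)
    (hW : DifferentiableAt ℝ W w) {a : ℂ} (h : ∀ᶠ u in 𝓝 w, V u ⬝ᵥ W u = a) :
    ∇[F, c] V w ⬝ᵥ W w + V w ⬝ᵥ ∇[F, c] W w = 0 := by
  rw [← wirtingerOp_dotProduct hV hW, wirtingerOp_congr h, wirtingerOp_const]

theorem complexCovDeriv_smul {g : ℂ → ℂ} (hg : DifferentiableAt ℝ g w)
    (hW : DifferentiableAt ℝ W w) :
    ∇[F, c] (fun u => g u • W u) w = ∂[c] g w • W w + g w • ∇[F, c] W w := by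
  rw [complexCovDeriv, wirtingerOp_smul hg hW, map_smul, add_assoc, ← smul_add, complexCovDeriv]

theorem wirtingerOp_complexVel (hF : ContDiffAt ℝ 2 (fun u => (F u).coords) w) :
    ∂[c] (complexVel F d) w = ∂[c] (∂[d] (complexCoords F)) w +
      (∂[c] (complexCoords F) w 0 * ∂[d] (complexCoords F) w 1 +
        complexCoords F w 0 * ∂[c] (∂[d] (complexCoords F)) w 1) • ![0, 0, -1] := by
  have hX := contDiffAt_complexCoords hF
  have hX' := hX.differentiableAt two_ne_zero
  have hdX : DifferentiableAt ℝ (∂[d] (complexCoords F)) w :=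
    (contDiffAt_wirtingerOp (m := 1) hX (by norm_num)).differentiableAt one_ne_zero
  rw [wirtingerOp_congr (complexVel_eventuallyEq (hF.of_le (by norm_num))),
    wirtingerOp_add hdX (by fun_prop), wirtingerOp_smul (by fun_prop) (by fun_prop),
    wirtingerOp_mul (by fun_prop) (by fun_prop), wirtingerOp_const, ← wirtingerOp_apply hX',
    ← wirtingerOp_apply hdX, smul_zero, add_zero]

theorem complexCovDeriv_complexVel_comm (hF : ContDiffAt ℝ 2 (fun u => (F u).coords) w) :
    ∇[F, c] (complexVel F d) w = ∇[F, d] (complexVel F c) w := by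
  have hV (a : ℂ) := complexVel_eq_wirtingerOp (c := a) (hF.differentiableAt two_ne_zero)
  rw [complexCovDeriv, complexCovDeriv, ← sub_eq_zero, add_sub_add_comm, leviCivita_sub_swap,
    wirtingerOp_complexVel hF, wirtingerOp_complexVel hF, hV c, hV d,
    wirtingerOp_comm (c := c) (contDiffAt_complexCoords hF)]
  ext k
  fin_cases k <;> simp [cross_apply, Matrix.vecHead, Matrix.vecTail]
  ring

theorem complexCovDeriv_commutator (hF : ContDiffAt ℝ 2 (fun u => (F u).coords) w)
    (hW : ContDiffAt ℝ 2 W w) :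
    ∇[F, c] (∇[F, d] W) w - ∇[F, d] (∇[F, c] W) w =
      (![0, 0, (complexVel F c w ⨯₃ complexVel F d w) 2] -
        (4⁻¹ : ℂ) • complexVel F c w ⨯₃ complexVel F d w) ⨯₃ W w := by
  have hV (a : ℂ) : ContDiffAt ℝ 1 (complexVel F a) w := contDiffAt_complexVel hF (by norm_num)
  have hdW (a : ℂ) : ContDiffAt ℝ 1 (∂[a] W) w := contDiffAt_wirtingerOp hW (by norm_num)
  have hW₁ : ContDiffAt ℝ 1 W w := hW.of_le (by norm_num)
  have expand (a b : ℂ) : ∇[F, a] (∇[F, b] W) w = ∂[a] (∂[b] W) w +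
      (leviCivita (∂[a] (complexVel F b) w) (W w) +
        leviCivita (complexVel F b w) (∂[a] W w)) +
      leviCivita (complexVel F a w) (∂[b] W w + leviCivita (complexVel F b w) (W w)) := by
    refine congrArg (· + _) ?_
    rw [← wirtingerOp_bilinear leviCivita ((hV b).differentiableAt one_ne_zero)
      (hW₁.differentiableAt one_ne_zero)]
    exact wirtingerOp_add ((hdW b).differentiableAt one_ne_zero)
      ((contDiffAt_bilinear leviCivita (hV b) hW₁).differentiableAt one_ne_zero)
  have torsion : leviCivita (complexVel F c w) (complexVel F d w) -
      leviCivita (complexVel F d w) (complexVel F c w) =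
      ∂[d] (complexVel F c) w - ∂[c] (complexVel F d) w := by
    have comm := complexCovDeriv_complexVel_comm (c := c) (d := d) hF
    simp only [complexCovDeriv] at comm
    linear_combination comm
  rw [← leviCivita_curvature, torsion, expand, expand, wirtingerOp_comm hW]
  simp only [map_add, map_sub, LinearMap.sub_apply]
  abel

/-- The unit normal, regarded as a complexified vector field. -/
def complexNormal (F : ℂ → Nil) (w : ℂ) : Fin 3 → ℂ := fun k => normal F w k

theorem complexCovDeriv_complexVel_apply (hF : ContDiffAt ℝ 2 (fun u => (F u).coords) w)
    (k : Fin 3) :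
    ∇[F, c] (complexVel F d) w k =
      (covDeriv F 1 (vel F 1) w k + c * covDeriv F I (vel F 1) w k +
        d * (covDeriv F 1 (vel F I) w k + c * covDeriv F I (vel F I) w k)) / 4 := by
  have hV : DifferentiableAt ℝ (complexVel F d) w :=
    (contDiffAt_complexVel (m := 1) hF (by norm_num)).differentiableAt one_ne_zero
  have hvel (v : ℂ) : DifferentiableAt ℝ (fun u => vel F v u k) w :=
    differentiableAt_pi.mp
      ((contDiffAt_vel (m := 1) hF (by norm_num) v).differentiableAt one_ne_zero) k
  have hvelC (v : ℂ) : DifferentiableAt ℝ (fun u => (vel F v u k : ℂ)) w :=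
    Complex.ofRealCLM.differentiableAt.comp w (hvel v)
  have hderiv : ∂[c] (fun u => complexVel F d u k) w =
      (∂[c] (fun u => (vel F 1 u k : ℂ)) w + d * ∂[c] (fun u => (vel F I u k : ℂ)) w) / 2 := by
    have hsum : (fun u => complexVel F d u k) =
        fun u => (2⁻¹ : ℂ) * (vel F 1 u k + d * vel F I u k) := by
      funext u
      simp only [complexVel]
      ring
    rw [hsum, wirtingerOp_mul (by fun_prop) (by fun_prop),
      wirtingerOp_add (hvelC 1) (by fun_prop), wirtingerOp_mul (by fun_prop) (hvelC I)]
    simp only [wirtingerOp_const]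
    ring
  rw [complexCovDeriv, Pi.add_apply, wirtingerOp_apply hV, hderiv, wirtingerOp_ofReal (hvel 1),
    wirtingerOp_ofReal (hvel I), ← sum_nabla_eq_leviCivita]
  simp only [covDeriv, complexVel, Fin.sum_univ_three]
  push_cast
  ring

theorem complexCovDeriv_complexVel_dotProduct_complexNormal
    (hF : ContDiffAt ℝ 2 (fun u => (F u).coords) w) :
    ∇[F, c] (complexVel F d) w ⬝ᵥ complexNormal F w =
      (secondForm F 1 1 w + c * secondForm F I 1 w +
        d * (secondForm F 1 I w + c * secondForm F I I w)) / 4 := by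
  simp only [dotProduct, Fin.sum_univ_three, complexCovDeriv_complexVel_apply hF, secondForm,
    complexNormal]
  push_cast
  ring

theorem secondForm_comm (hF : ContDiffAt ℝ 2 (fun u => (F u).coords) w) :
    secondForm F I 1 w = secondForm F 1 I w := by
  have h := congrArg (· ⬝ᵥ complexNormal F w)
    (complexCovDeriv_complexVel_comm (c := 0) (d := 1) hF)
  simp only [complexCovDeriv_complexVel_dotProduct_complexNormal hF] at h
  exact_mod_cast (show (secondForm F I 1 w : ℂ) = secondForm F 1 I w by linear_combination -4 * h)

theorem hopfCoeff_eq (hF : ContDiffAt ℝ 2 (fun u => (F u).coords) w) :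
    hopfCoeff F w = ∇[F, -I] (complexVel F (-I)) w ⬝ᵥ complexNormal F w := by
  have hV : DifferentiableAt ℝ (complexVel F (-I)) w :=
    (contDiffAt_complexVel (m := 1) hF (by norm_num)).differentiableAt one_ne_zero
  refine Finset.sum_congr rfl fun k _ => ?_
  simp only [sum_nabla_eq_leviCivita (fun j => Z F j w), wirtinger_eq_wirtingerOp,
    complexCovDeriv, Pi.add_apply, wirtingerOp_apply hV, complexVel_neg_I, complexNormal]

theorem complexVel_dotProduct (F : ℂ → Nil) (c d w : ℂ) :
    complexVel F c w ⬝ᵥ complexVel F d w =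
      (firstForm F 1 1 w + (c + d) * firstForm F 1 I w + c * d * firstForm F I I w) / 4 := by
  simp only [complexVel, firstForm, dotProduct, Fin.sum_univ_three]
  push_cast
  ring

theorem complexVel_cross (F : ℂ → Nil) (c d w : ℂ) :
    complexVel F c w ⨯₃ complexVel F d w =
      ((d - c) / 4) • fun k => (((vel F 1 w ⨯₃ vel F I w) k : ℝ) : ℂ) := by
  ext k
  fin_cases k <;> simp [complexVel, cross_apply] <;> ring

variable {G : ℂ → Nil} {φ : ℂ → ℂ}

theorem complexVel_comp (hG : DifferentiableAt ℝ (fun u => (G u).coords) (φ w))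
    (hφ : DifferentiableAt ℂ φ w) (hFG : F =ᶠ[𝓝 w] fun u => G (φ u)) (hc : c * c = -1) :
    complexVel F c w =
      ((deriv φ w).re - c * (deriv φ w).im : ℂ) • complexVel G c (φ w) := by
  have hcoords : complexCoords F =ᶠ[𝓝 w] fun u => complexCoords G (φ u) :=
    hFG.mono fun u hu => by unfold complexCoords; rw [hu]
  have hF : DifferentiableAt ℝ (fun u => (F u).coords) w :=
    (hG.comp w (hφ.restrictScalars ℝ)).congr_of_eventuallyEq
      (hFG.mono fun u hu => by simp only [Function.comp_apply, hu])
  rw [complexVel_eq_wirtingerOp hF, complexVel_eq_wirtingerOp hG, wirtingerOp_congr hcoords,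
    wirtingerOp_comp_holomorphic hc hφ (differentiableAt_complexCoords hG),
    hcoords.eq_of_nhds]
  simp only [Pi.smul_apply, smul_eq_mul]
  module

theorem complexVel_neg_I_comp (hG : DifferentiableAt ℝ (fun u => (G u).coords) (φ w))
    (hφ : DifferentiableAt ℂ φ w) (hFG : F =ᶠ[𝓝 w] fun u => G (φ u)) :
    complexVel F (-I) w = deriv φ w • complexVel G (-I) (φ w) := by
  rw [complexVel_comp hG hφ hFG (by simp)]
  congr 1
  linear_combination Complex.re_add_im (deriv φ w)

theorem complexVel_I_comp (hG : DifferentiableAt ℝ (fun u => (G u).coords) (φ w))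
    (hφ : DifferentiableAt ℂ φ w) (hFG : F =ᶠ[𝓝 w] fun u => G (φ u)) :
    complexVel F I w = (starRingEnd ℂ) (deriv φ w) • complexVel G I (φ w) := by
  rw [complexVel_comp hG hφ hFG (by simp)]
  congr 1
  simp [Complex.ext_iff]

theorem complexCovDeriv_comp (hG : DifferentiableAt ℝ (fun u => (G u).coords) (φ w))
    (hφ : DifferentiableAt ℂ φ w) (hFG : F =ᶠ[𝓝 w] fun u => G (φ u)) (hc : c * c = -1)
    (hW : DifferentiableAt ℝ W (φ w)) :
    ∇[F, c] (fun u => W (φ u)) w =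
      ((deriv φ w).re - c * (deriv φ w).im : ℂ) • ∇[G, c] W (φ w) := by
  rw [complexCovDeriv, complexVel_comp hG hφ hFG hc, wirtingerOp_comp_holomorphic hc hφ hW,
    map_smul, LinearMap.smul_apply, ← smul_add, complexCovDeriv]

end CovariantDerivative

local notation:max "∇[" F ", " c "]" => complexCovDeriv F c

theorem two_mul_ofReal_add_I_ne_zero (x : ℝ) : (2 * x + I : ℂ) ≠ 0 := fun h => by
  simpa using congrArg Complex.im h

theorem norm_two_mul_ofReal_add_I_sq (x : ℝ) : ‖(2 * x + I : ℂ)‖ ^ 2 = 4 * x ^ 2 + 1 := by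
  rw [← Complex.normSq_eq_norm_sq, Complex.normSq_apply]
  simp only [Complex.add_re, Complex.add_im, Complex.mul_re, Complex.mul_im, Complex.ofReal_re,
    Complex.ofReal_im, Complex.I_re, Complex.I_im, Complex.re_ofNat, Complex.im_ofNat]
  ring

/-- `F` restricts to a smooth conformal immersion of the open set `U` into `Nil`; this is
`IsConformalImmersion` for one local complex parameter. -/
structure IsConformalImmersionOn (F : ℂ → Nil) (U : Set ℂ) : Prop where
  isOpen : IsOpen U
  smooth : ContDiffOn ℝ ∞ (fun u => (F u).coords) U
  pos : ∀ w ∈ U, 0 < firstForm F 1 1 w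
  eq : ∀ w ∈ U, firstForm F I I w = firstForm F 1 1 w
  orthogonal : ∀ w ∈ U, firstForm F 1 I w = 0

namespace IsConformalImmersionOn

variable {F : ℂ → Nil} {U : Set ℂ} {d w : ℂ}

theorem mono {V : Set ℂ} (h : IsConformalImmersionOn F U) (hV : IsOpen V) (hVU : V ⊆ U) :
    IsConformalImmersionOn F V :=
  ⟨hV, h.smooth.mono hVU, fun w hw => h.pos w (hVU hw), fun w hw => h.eq w (hVU hw),
    fun w hw => h.orthogonal w (hVU hw)⟩

theorem contDiffAt (h : IsConformalImmersionOn F U) (hw : w ∈ U) :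
    ContDiffAt ℝ ∞ (fun u => (F u).coords) w :=
  h.smooth.contDiffAt (h.isOpen.mem_nhds hw)

theorem contDiffAt_two (h : IsConformalImmersionOn F U) (hw : w ∈ U) :
    ContDiffAt ℝ 2 (fun u => (F u).coords) w :=
  (h.contDiffAt hw).of_le ENat.LEInfty.out

theorem differentiableAt_coords (h : IsConformalImmersionOn F U) (hw : w ∈ U) :
    DifferentiableAt ℝ (fun u => (F u).coords) w :=
  (h.contDiffAt_two hw).differentiableAt two_ne_zero

theorem ofReal_firstForm_ne_zero (h : IsConformalImmersionOn F U) (hw : w ∈ U) :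
    (firstForm F 1 1 w : ℂ) ≠ 0 :=
  Complex.ofReal_ne_zero.mpr (h.pos w hw).ne'

theorem complexVel_dotProduct (h : IsConformalImmersionOn F U) (hw : w ∈ U) (c d : ℂ) :
    complexVel F c w ⬝ᵥ complexVel F d w = (1 + c * d) / 4 * firstForm F 1 1 w := by
  rw [NilGeometry.complexVel_dotProduct, h.eq w hw, h.orthogonal w hw]
  push_cast
  ring

theorem smul_normal (h : IsConformalImmersionOn F U) (hw : w ∈ U) :
    firstForm F 1 1 w • normal F w = vel F 1 w ⨯₃ vel F I w := by
  have gram : vel F 1 w ⨯₃ vel F I w ⬝ᵥ vel F 1 w ⨯₃ vel F I w = firstForm F 1 1 w ^ 2 := by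
    have ho := h.orthogonal w hw
    have he := h.eq w hw
    rw [cross_dot_cross, dotProduct_comm (vel F I w) (vel F 1 w)]
    simp only [firstForm] at ho he ⊢
    rw [ho, he]
    ring
  rw [normal, gram, Real.sqrt_sq (h.pos w hw).le, smul_inv_smul₀ (h.pos w hw).ne']

theorem complexVel_cross (h : IsConformalImmersionOn F U) (hw : w ∈ U) (c d : ℂ) :
    complexVel F c w ⨯₃ complexVel F d w =
      ((d - c) / 4 * firstForm F 1 1 w) • complexNormal F w := by
  rw [NilGeometry.complexVel_cross, ← h.smul_normal hw, mul_smul]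
  congr 1
  ext k
  simp [complexNormal]

theorem complexNormal_dotProduct_complexVel (h : IsConformalImmersionOn F U) (hw : w ∈ U)
    (c : ℂ) : complexNormal F w ⬝ᵥ complexVel F c w = 0 := by
  have hcross := h.complexVel_cross hw c (c + 1)
  have horth := dot_self_cross (complexVel F c w) (complexVel F (c + 1) w)
  rw [hcross, dotProduct_smul, smul_eq_mul, dotProduct_comm] at horth
  refine (mul_eq_zero.mp horth).resolve_left (mul_ne_zero ?_ (h.ofReal_firstForm_ne_zero hw))
  norm_num

theorem complexNormal_dotProduct_self (h : IsConformalImmersionOn F U) (hw : w ∈ U) :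
    complexNormal F w ⬝ᵥ complexNormal F w = 1 := by
  have hne := h.ofReal_firstForm_ne_zero hw
  have hcross := cross_dot_cross (complexVel F (-I) w) (complexVel F I w) (complexVel F (-I) w)
    (complexVel F I w)
  simp only [h.complexVel_cross hw, h.complexVel_dotProduct hw, smul_dotProduct,
    dotProduct_smul, smul_eq_mul] at hcross
  refine mul_left_cancel₀ (pow_ne_zero 2 hne) ?_
  linear_combination -4 * hcross + (firstForm F 1 1 w : ℂ) ^ 2 *
    (complexNormal F w ⬝ᵥ complexNormal F w - 1) * Complex.I_mul_I

theorem eq_of_dotProduct_eq (h : IsConformalImmersionOn F U) (hw : w ∈ U) {v v' : Fin 3 → ℂ}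
    (hZ : complexVel F (-I) w ⬝ᵥ v = complexVel F (-I) w ⬝ᵥ v')
    (hZbar : complexVel F I w ⬝ᵥ v = complexVel F I w ⬝ᵥ v')
    (hN : complexNormal F w ⬝ᵥ v = complexNormal F w ⬝ᵥ v') : v = v' := by
  have hne := h.ofReal_firstForm_ne_zero hw
  refine eq_of_dotProduct_eq_of_cross ?_ hZ hZbar ?_
  · rw [h.complexVel_cross hw, smul_dotProduct, dotProduct_smul,
      h.complexNormal_dotProduct_self hw]
    simp [hne, Complex.I_ne_zero]
  · rw [h.complexVel_cross hw, smul_dotProduct, smul_dotProduct, hN]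

theorem complexNormal_cross_complexVel_neg_I (h : IsConformalImmersionOn F U) (hw : w ∈ U) :
    complexNormal F w ⨯₃ complexVel F (-I) w = I • complexVel F (-I) w := by
  have hne := h.ofReal_firstForm_ne_zero hw
  have hcross := cross_cross_eq_smul_sub_smul (complexVel F (-I) w) (complexVel F I w)
    (complexVel F (-I) w)
  simp only [h.complexVel_cross hw, map_smul, LinearMap.smul_apply,
    h.complexVel_dotProduct hw] at hcross
  ext k
  refine mul_left_cancel₀ hne ?_
  have hk := congrFun hcross k
  simp only [Pi.smul_apply, Pi.sub_apply, smul_eq_mul] at hk ⊢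
  linear_combination -2 * I * hk + (firstForm F 1 1 w : ℂ) *
    ((complexNormal F w ⨯₃ complexVel F (-I) w) k -
      I / 2 * (complexVel F I w k + complexVel F (-I) w k)) * Complex.I_mul_I

theorem contDiffAt_complexVel (h : IsConformalImmersionOn F U) (hw : w ∈ U) (c : ℂ) :
    ContDiffAt ℝ ∞ (complexVel F c) w :=
  NilGeometry.contDiffAt_complexVel (h.contDiffAt hw) (by simp)

theorem contDiffAt_firstForm (h : IsConformalImmersionOn F U) (hw : w ∈ U) :
    ContDiffAt ℝ ∞ (firstForm F 1 1) w := by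
  have hvel := contDiffAt_pi.mp (contDiffAt_vel (h.contDiffAt hw) (m := ∞) (by simp) 1)
  change ContDiffAt ℝ ∞ (fun u => ∑ k, vel F 1 u k * vel F 1 u k) w
  fun_prop

theorem contDiffAt_complexNormal (h : IsConformalImmersionOn F U) (hw : w ∈ U) :
    ContDiffAt ℝ ∞ (complexNormal F) w := by
  have hZ := h.contDiffAt_complexVel hw (-I)
  have hZbar := h.contDiffAt_complexVel hw I
  have hcoef : ContDiffAt ℝ ∞ (fun u => ((I - -I) / 4 * firstForm F 1 1 u : ℂ)) w :=
    contDiffAt_const.mul (contDiffAt_ofReal (h.contDiffAt_firstForm hw))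
  have hcoef_ne {u : ℂ} (hu : u ∈ U) : ((I - -I) / 4 * firstForm F 1 1 u : ℂ) ≠ 0 := by
    simp [h.ofReal_firstForm_ne_zero hu, Complex.I_ne_zero]
  have hN : complexNormal F =ᶠ[𝓝 w] fun u =>
      ((I - -I) / 4 * firstForm F 1 1 u : ℂ)⁻¹ • (complexVel F (-I) u ⨯₃ complexVel F I u) := by
    filter_upwards [h.isOpen.mem_nhds hw] with u hu
    rw [h.complexVel_cross hu, inv_smul_smul₀ (hcoef_ne hu)]
  exact ((hcoef.inv (hcoef_ne hw)).smul
    (contDiffAt_bilinear crossProduct hZ hZbar)).congr_of_eventuallyEq hN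

theorem firstForm_mul_meanCurv (h : IsConformalImmersionOn F U) (hw : w ∈ U) :
    firstForm F 1 1 w * meanCurv F w = (secondForm F 1 1 w + secondForm F I I w) / 2 := by
  have hpos := h.pos w hw
  rw [meanCurv, h.eq w hw, h.orthogonal w hw]
  field_simp
  ring

theorem complexCovDeriv_I_dotProduct_complexNormal (h : IsConformalImmersionOn F U)
    (hw : w ∈ U) :
    ∇[F, I] (complexVel F (-I)) w ⬝ᵥ complexNormal F w =
      firstForm F 1 1 w * meanCurv F w / 2 := by
  have hF := h.contDiffAt_two hw
  have hH : (firstForm F 1 1 w * meanCurv F w : ℂ) =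
      (secondForm F 1 1 w + secondForm F I I w) / 2 := by
    exact_mod_cast congrArg Complex.ofReal (h.firstForm_mul_meanCurv hw)
  rw [complexCovDeriv_complexVel_dotProduct_complexNormal hF, hH, secondForm_comm hF]
  linear_combination -(secondForm F I I w : ℂ) / 4 * Complex.I_mul_I

theorem complexCovDeriv_dotProduct_complexVel_self (h : IsConformalImmersionOn F U)
    (hw : w ∈ U) (c : ℂ) (hd : d * d = -1) :
    ∇[F, c] (complexVel F d) w ⬝ᵥ complexVel F d w = 0 := by
  have hV := (h.contDiffAt_complexVel hw d).differentiableAt (by simp)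
  have hisotropic : ∀ᶠ u in 𝓝 w, complexVel F d u ⬝ᵥ complexVel F d u = 0 := by
    filter_upwards [h.isOpen.mem_nhds hw] with u hu
    rw [h.complexVel_dotProduct hu, hd]
    ring
  have key := complexCovDeriv_dotProduct_add_eq_zero (F := F) (c := c) hV hV hisotropic
  rw [dotProduct_comm (complexVel F d w)] at key
  linear_combination key / 2

theorem complexCovDeriv_I_complexVel_neg_I (h : IsConformalImmersionOn F U) (hw : w ∈ U) :
    ∇[F, I] (complexVel F (-I)) w =
      (firstForm F 1 1 w * meanCurv F w / 2 : ℂ) • complexNormal F w := by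
  have hF := h.contDiffAt_two hw
  apply h.eq_of_dotProduct_eq hw <;> rw [dotProduct_smul, smul_eq_mul, dotProduct_comm]
  · rw [h.complexCovDeriv_dotProduct_complexVel_self hw I (by simp), dotProduct_comm,
      h.complexNormal_dotProduct_complexVel hw, mul_zero]
  · rw [complexCovDeriv_complexVel_comm hF,
      h.complexCovDeriv_dotProduct_complexVel_self hw (-I) (by simp), dotProduct_comm,
      h.complexNormal_dotProduct_complexVel hw, mul_zero]
  · rw [h.complexCovDeriv_I_dotProduct_complexNormal hw, h.complexNormal_dotProduct_self hw,
      mul_one]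

theorem contDiffAt_complexCovDeriv_complexVel (h : IsConformalImmersionOn F U) (hw : w ∈ U)
    (c d : ℂ) : ContDiffAt ℝ ∞ (∇[F, c] (complexVel F d)) w :=
  contDiffAt_complexCovDeriv (h.contDiffAt hw) (h.contDiffAt_complexVel hw d) (by simp)

theorem contDiffAt_meanCurv (h : IsConformalImmersionOn F U) (hw : w ∈ U) :
    ContDiffAt ℝ ∞ (meanCurv F) w := by
  have hdot := contDiffAt_bilinear (dotProductBilin ℂ ℂ)
    (h.contDiffAt_complexCovDeriv_complexVel hw I (-I)) (h.contDiffAt_complexNormal hw)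
  have hre := Complex.reCLM.contDiff.contDiffAt.comp w hdot
  refine ((contDiffAt_const (c := (2 : ℝ))).mul (hre.mul ((h.contDiffAt_firstForm hw).inv
    (h.pos w hw).ne'))).congr_of_eventuallyEq ?_
  filter_upwards [h.isOpen.mem_nhds hw] with u hu
  have hpos := h.pos u hu
  simp only [Function.comp_apply, dotProductBilin_apply_apply, Complex.reCLM_apply, Pi.inv_apply]
  rw [h.complexCovDeriv_I_dotProduct_complexNormal hu, ← Complex.ofReal_mul,
    ← Complex.ofReal_ofNat, ← Complex.ofReal_div, Complex.ofReal_re]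
  field_simp

theorem wirtingerOp_I_complexVel_neg_I_two (h : IsConformalImmersionOn F U) (hw : w ∈ U) :
    ∂[I] (complexVel F (-I)) w 2 =
      firstForm F 1 1 w * complexNormal F w 2 * (2 * meanCurv F w + I) / 4 := by
  have hcov := congrFun (h.complexCovDeriv_I_complexVel_neg_I hw) 2
  have htors := congrFun (h.complexVel_cross hw (-I) I) 2
  simp only [complexCovDeriv, leviCivita_apply, cross_apply, Pi.add_apply, Pi.smul_apply,
    smul_eq_mul, Matrix.cons_val] at hcov htors
  linear_combination hcov + htors / 2

theorem four_mul_norm_Z_two_sq (h : IsConformalImmersionOn F U) (hw : w ∈ U) :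
    4 * ‖Z F 2 w‖ ^ 2 = firstForm F 1 1 w * (1 - normal F w 2 ^ 2) := by
  have expand : (firstForm F 1 1 w : ℂ) • ![0, 0, 1] =
      (2 * complexVel F I w 2) • complexVel F (-I) w +
        (2 * complexVel F (-I) w 2) • complexVel F I w +
        (firstForm F 1 1 w * complexNormal F w 2 : ℂ) • complexNormal F w := by
    have hN := h.complexNormal_dotProduct_complexVel hw
    apply h.eq_of_dotProduct_eq hw <;>
      simp only [dotProduct_add, dotProduct_smul, h.complexVel_dotProduct hw, hN,
        dotProduct_comm _ (complexNormal F w), h.complexNormal_dotProduct_self hw]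
    · simp only [dotProduct, Fin.sum_univ_three, Matrix.cons_val, smul_eq_mul, neg_mul, mul_neg,
        Complex.I_mul_I]
      ring
    · simp only [dotProduct, Fin.sum_univ_three, Matrix.cons_val, smul_eq_mul, mul_neg,
        Complex.I_mul_I]
      ring
    · simp [dotProduct, Fin.sum_univ_three]
  have hconj : complexVel F I w 2 = (starRingEnd ℂ) (Z F 2 w) := by
    simp [complexVel, Z, Complex.conj_ofNat]
  have hexp := congrFun expand 2
  simp only [complexVel_neg_I, hconj, complexNormal, Pi.add_apply, Pi.smul_apply, smul_eq_mul,
    Matrix.cons_val] at hexp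
  have hnorm := Complex.mul_conj' (Z F 2 w)
  exact_mod_cast (show (4 * ‖Z F 2 w‖ ^ 2 : ℂ) = firstForm F 1 1 w * (1 - normal F w 2 ^ 2) by
    linear_combination -4 * hnorm - hexp)

theorem hopfCoeff_eventuallyEq (h : IsConformalImmersionOn F U) (hw : w ∈ U) :
    hopfCoeff F =ᶠ[𝓝 w] fun u => ∇[F, -I] (complexVel F (-I)) u ⬝ᵥ complexNormal F u := by
  filter_upwards [h.isOpen.mem_nhds hw] with u hu using hopfCoeff_eq (h.contDiffAt_two hu)

theorem contDiffAt_hopfCoeff (h : IsConformalImmersionOn F U) (hw : w ∈ U) :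
    ContDiffAt ℝ ∞ (hopfCoeff F) w :=
  (contDiffAt_bilinear (dotProductBilin ℂ ℂ) (h.contDiffAt_complexCovDeriv_complexVel hw _ _)
    (h.contDiffAt_complexNormal hw)).congr_of_eventuallyEq (h.hopfCoeff_eventuallyEq hw)

theorem complexCovDeriv_neg_I_dotProduct_complexVel_I (h : IsConformalImmersionOn F U)
    (hw : w ∈ U) :
    ∇[F, -I] (complexVel F (-I)) w ⬝ᵥ complexVel F I w =
      ∂[-I] (fun u => (firstForm F 1 1 u : ℂ)) w / 2 := by
  have hV (c : ℂ) := (h.contDiffAt_complexVel hw c).differentiableAt (by simp)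
  have hlam := (contDiffAt_ofReal (h.contDiffAt_firstForm hw)).differentiableAt (by simp)
  have hlam_eq : (fun u => complexVel F (-I) u ⬝ᵥ complexVel F I u) =ᶠ[𝓝 w]
      fun u => (2⁻¹ : ℂ) * firstForm F 1 1 u := by
    filter_upwards [h.isOpen.mem_nhds hw] with u hu
    rw [h.complexVel_dotProduct hu, neg_mul, Complex.I_mul_I]
    ring
  have product := wirtingerOp_dotProduct (F := F) (c := -I) (hV (-I)) (hV I)
  rw [wirtingerOp_congr hlam_eq, wirtingerOp_mul (by fun_prop) hlam, wirtingerOp_const,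
    complexCovDeriv_complexVel_comm (c := -I) (d := I) (h.contDiffAt_two hw),
    dotProduct_comm (complexVel F (-I) w),
    h.complexCovDeriv_dotProduct_complexVel_self hw I (by simp)] at product
  linear_combination -product

theorem smul_complexCovDeriv_neg_I (h : IsConformalImmersionOn F U) (hw : w ∈ U) :
    (firstForm F 1 1 w : ℂ) • ∇[F, -I] (complexVel F (-I)) w =
      ∂[-I] (fun u => (firstForm F 1 1 u : ℂ)) w • complexVel F (-I) w +
        (firstForm F 1 1 w * hopfCoeff F w) • complexNormal F w := by
  have hN := h.complexNormal_dotProduct_complexVel hw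
  apply h.eq_of_dotProduct_eq hw <;>
    rw [dotProduct_add, dotProduct_smul, dotProduct_smul, dotProduct_smul,
      dotProduct_comm _ (∇[F, -I] _ _)]
  · rw [h.complexCovDeriv_dotProduct_complexVel_self hw (-I) (by simp), dotProduct_comm _
      (complexNormal F w), hN, h.complexVel_dotProduct hw]
    simp
  · rw [h.complexCovDeriv_neg_I_dotProduct_complexVel_I hw, dotProduct_comm _
      (complexNormal F w), hN, h.complexVel_dotProduct hw, mul_neg, Complex.I_mul_I]
    simp only [smul_eq_mul]
    ring
  · rw [← hopfCoeff_eq (h.contDiffAt_two hw), hN, h.complexNormal_dotProduct_self hw]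
    simp

theorem curvature_dotProduct_complexNormal (h : IsConformalImmersionOn F U) (hw : w ∈ U) :
    (∇[F, I] (∇[F, -I] (complexVel F (-I))) w - ∇[F, -I] (∇[F, I] (complexVel F (-I))) w) ⬝ᵥ
      complexNormal F w = -(firstForm F 1 1 w * complexNormal F w 2 * Z F 2 w) / 2 := by
  have hZ : ContDiffAt ℝ 2 (complexVel F (-I)) w :=
    (h.contDiffAt_complexVel hw _).of_le ENat.LEInfty.out
  rw [complexCovDeriv_commutator (h.contDiffAt_two hw) hZ, h.complexVel_cross hw, dotProduct_comm,
    triple_product_permutation, ← cross_anticomm (complexNormal F w),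
    h.complexNormal_cross_complexVel_neg_I hw, sub_dotProduct]
  have hperp := h.complexNormal_dotProduct_complexVel hw (-I)
  have hvert : ![0, 0, (((-I - I) / 4 * firstForm F 1 1 w) • complexNormal F w) 2] ⬝ᵥ
      complexVel F (-I) w = (-I - I) / 4 * firstForm F 1 1 w * complexNormal F w 2 * Z F 2 w := by
    simp [dotProduct, Fin.sum_univ_three, complexVel_neg_I]
  simp only [dotProduct_neg, dotProduct_smul, smul_dotProduct, hperp, hvert, smul_eq_mul]
  linear_combination
    (firstForm F 1 1 w * complexNormal F w 2 * Z F 2 w : ℂ) / 2 * Complex.I_mul_I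

theorem complexNormal_dotProduct_complexCovDeriv (h : IsConformalImmersionOn F U) (hw : w ∈ U)
    (c : ℂ) : complexNormal F w ⬝ᵥ ∇[F, c] (complexNormal F) w = 0 := by
  have hN := (h.contDiffAt_complexNormal hw).differentiableAt (by simp)
  have hunit : ∀ᶠ u in 𝓝 w, complexNormal F u ⬝ᵥ complexNormal F u = 1 := by
    filter_upwards [h.isOpen.mem_nhds hw] with u hu using h.complexNormal_dotProduct_self hu
  have key := complexCovDeriv_dotProduct_add_eq_zero (F := F) (c := c) hN hN hunit
  rw [dotProduct_comm _ (complexNormal F w)] at key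
  linear_combination key / 2

theorem complexCovDeriv_complexCovDeriv_I_dotProduct_complexNormal
    (h : IsConformalImmersionOn F U) (hw : w ∈ U) :
    ∇[F, -I] (∇[F, I] (complexVel F (-I))) w ⬝ᵥ complexNormal F w =
      (∂[-I] (fun u => (firstForm F 1 1 u : ℂ)) w * meanCurv F w +
        firstForm F 1 1 w * ∂[-I] (fun u => (meanCurv F u : ℂ)) w) / 2 := by
  have hN := (h.contDiffAt_complexNormal hw).differentiableAt (by simp)
  have hlam := (contDiffAt_ofReal (h.contDiffAt_firstForm hw)).differentiableAt (by simp)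
  have hH := (contDiffAt_ofReal (h.contDiffAt_meanCurv hw)).differentiableAt (by simp)
  have hDZ : ∇[F, I] (complexVel F (-I)) =ᶠ[𝓝 w]
      fun u => (2⁻¹ * (firstForm F 1 1 u * meanCurv F u) : ℂ) • complexNormal F u := by
    filter_upwards [h.isOpen.mem_nhds hw] with u hu
    rw [h.complexCovDeriv_I_complexVel_neg_I hu, div_eq_inv_mul]
  rw [complexCovDeriv_congr hDZ, complexCovDeriv_smul (by fun_prop) hN,
    wirtingerOp_mul (by fun_prop) (by fun_prop), wirtingerOp_mul hlam hH, wirtingerOp_const,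
    add_dotProduct, smul_dotProduct, smul_dotProduct, h.complexNormal_dotProduct_self hw,
    dotProduct_comm (∇[F, -I] _ _), h.complexNormal_dotProduct_complexCovDeriv hw]
  simp only [smul_eq_mul]
  ring

theorem wirtingerOp_I_hopfCoeff (h : IsConformalImmersionOn F U) (hw : w ∈ U) :
    ∂[I] (hopfCoeff F) w = firstForm F 1 1 w / 2 *
      (∂[-I] (fun u => (meanCurv F u : ℂ)) w - complexNormal F w 2 * Z F 2 w) := by
  have hZ := h.contDiffAt_complexVel hw (-I)
  have hN := (h.contDiffAt_complexNormal hw).differentiableAt (by simp)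
  have hDZ := (h.contDiffAt_complexCovDeriv_complexVel hw (-I) (-I)).differentiableAt (by simp)
  have hDN : complexVel F (-I) w ⬝ᵥ ∇[F, I] (complexNormal F) w =
      -(firstForm F 1 1 w * meanCurv F w / 2) := by
    have horth : ∀ᶠ u in 𝓝 w, complexVel F (-I) u ⬝ᵥ complexNormal F u = 0 := by
      filter_upwards [h.isOpen.mem_nhds hw] with u hu
      rw [dotProduct_comm, h.complexNormal_dotProduct_complexVel hu]
    have key := complexCovDeriv_dotProduct_add_eq_zero (F := F) (c := I)
      (hZ.differentiableAt (by simp)) hN horth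
    rw [h.complexCovDeriv_I_dotProduct_complexNormal hw] at key
    linear_combination key
  have hshape := congrArg (· ⬝ᵥ ∇[F, I] (complexNormal F) w) (h.smul_complexCovDeriv_neg_I hw)
  have hcurv := h.curvature_dotProduct_complexNormal hw
  simp only [smul_dotProduct, add_dotProduct, sub_dotProduct, smul_eq_mul, hDN,
    h.complexNormal_dotProduct_complexCovDeriv hw,
    h.complexCovDeriv_complexCovDeriv_I_dotProduct_complexNormal hw] at hshape hcurv
  rw [wirtingerOp_congr (h.hopfCoeff_eventuallyEq hw), wirtingerOp_dotProduct (F := F) hDZ hN]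
  refine mul_left_cancel₀ (h.ofReal_firstForm_ne_zero hw) ?_
  linear_combination hshape + firstForm F 1 1 w * hcurv

theorem wirtingerOp_I_modifiedHopfCoeff (h : IsConformalImmersionOn F U) (hw : w ∈ U) :
    ∂[I] (modifiedHopfCoeff F) w =
      firstForm F 1 1 w / 2 * ∂[-I] (fun u => (meanCurv F u : ℂ)) w -
        2 * ∂[I] (fun u => (meanCurv F u : ℂ)) w * Z F 2 w ^ 2 / (2 * meanCurv F w + I) ^ 2 := by
  have hZ := (h.contDiffAt_complexVel hw (-I)).differentiableAt (by simp)
  have hZ₃ : DifferentiableAt ℝ (Z F 2) w := by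
    simpa only [complexVel_neg_I] using differentiableAt_pi.mp hZ 2
  have hH := (contDiffAt_ofReal (h.contDiffAt_meanCurv hw)).differentiableAt (by simp)
  have hden : DifferentiableAt ℝ (fun u => (2 * meanCurv F u + I : ℂ)) w := by fun_prop
  have hden_ne := two_mul_ofReal_add_I_ne_zero (meanCurv F w)
  have hA := (h.contDiffAt_hopfCoeff hw).differentiableAt (by simp)
  have hquot : DifferentiableAt ℝ (fun u => Z F 2 u * Z F 2 u / (2 * meanCurv F u + I)) w :=
    (hZ₃.fun_mul hZ₃).fun_mul (hden.fun_inv hden_ne)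
  have hdZ : ∂[I] (Z F 2) w =
      firstForm F 1 1 w * complexNormal F w 2 * (2 * meanCurv F w + I) / 4 := by
    rw [← h.wirtingerOp_I_complexVel_neg_I_two hw, wirtingerOp_apply hZ]
    simp only [complexVel_neg_I]
  have hdden : ∂[I] (fun u => (2 * meanCurv F u + I : ℂ)) w =
      2 * ∂[I] (fun u => (meanCurv F u : ℂ)) w := by
    rw [wirtingerOp_add (by fun_prop) (by fun_prop), wirtingerOp_mul (by fun_prop) hH,
      wirtingerOp_const, wirtingerOp_const]
    ring
  simp only [funext (modifiedHopfCoeff.eq_1 F), sq (Z F 2 _)]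
  rw [wirtingerOp_add hA hquot,
    wirtingerOp_div (by fun_prop) hden hden_ne, wirtingerOp_mul hZ₃ hZ₃, hdZ, hdden,
    h.wirtingerOp_I_hopfCoeff hw]
  field_simp
  ring

theorem wirtingerOp_meanCurv_eq_zero_or_meanCurv_eq_zero (h : IsConformalImmersionOn F U)
    (hol : DifferentiableOn ℂ (modifiedHopfCoeff F) U) (hw : w ∈ U) :
    ∂[-I] (fun u => (meanCurv F u : ℂ)) w = 0 ∨ meanCurv F w = 0 := by
  have hpos := h.pos w hw
  have hden_ne := two_mul_ofReal_add_I_ne_zero (meanCurv F w)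
  have hdbar := wirtingerOp_I_eq_zero (hol.differentiableAt (h.isOpen.mem_nhds hw))
  rw [h.wirtingerOp_I_modifiedHopfCoeff hw, sub_eq_zero, eq_div_iff (pow_ne_zero 2 hden_ne)]
    at hdbar
  have hnorm := congrArg (‖·‖) hdbar
  simp only [norm_mul, norm_div, norm_pow, Complex.norm_real, Complex.norm_two,
    Real.norm_of_nonneg hpos.le, norm_two_mul_ofReal_add_I_sq, norm_wirtingerOp_I_ofReal
      ((h.contDiffAt_meanCurv hw).differentiableAt (by simp))] at hnorm
  rw [or_iff_not_imp_left]
  intro hdH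
  have hdH_pos := norm_pos_iff.mpr hdH
  have hcompare : firstForm F 1 1 w * (4 * meanCurv F w ^ 2 + normal F w 2 ^ 2) = 0 := by
    refine mul_right_cancel₀ hdH_pos.ne' ?_
    linear_combination 2 * hnorm + ‖∂[-I] (fun u => (meanCurv F u : ℂ)) w‖ *
      h.four_mul_norm_Z_two_sq hw
  have hsum := (mul_eq_zero.mp hcompare).resolve_left hpos.ne'
  nlinarith [sq_nonneg (normal F w 2), sq_nonneg (meanCurv F w)]

theorem fderiv_meanCurv_eq_zero (h : IsConformalImmersionOn F U)
    (hol : DifferentiableOn ℂ (modifiedHopfCoeff F) U) (hw : w ∈ U) :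
    fderiv ℝ (meanCurv F) w = 0 := by
  by_contra hdH
  have hH := h.contDiffAt_meanCurv hw
  have hcont : ContinuousAt (fderiv ℝ (meanCurv F)) w :=
    (hH.fderiv_right (m := 0) (by simp)).continuousAt
  have hzero : meanCurv F =ᶠ[𝓝 w] fun _ => 0 := by
    filter_upwards [h.isOpen.mem_nhds hw, hcont.eventually_ne hdH] with u hu hdu
    refine (h.wirtingerOp_meanCurv_eq_zero_or_meanCurv_eq_zero hol hu).resolve_left fun hd => hdu ?_
    exact fderiv_eq_zero_of_wirtingerOp_ofReal
      ((h.contDiffAt_meanCurv hu).differentiableAt (by simp)) hd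
  exact hdH (by rw [hzero.fderiv_eq, fderiv_const_apply])

variable {G : ℂ → Nil} {V : Set ℂ} {φ : ℂ → ℂ}

theorem firstForm_comp (h : IsConformalImmersionOn F U) (h' : IsConformalImmersionOn G V)
    (hw : w ∈ U) (hφw : φ w ∈ V) (hφ : DifferentiableAt ℂ φ w)
    (hFG : F =ᶠ[𝓝 w] fun u => G (φ u)) :
    (firstForm F 1 1 w : ℂ) =
      deriv φ w * (starRingEnd ℂ) (deriv φ w) * firstForm G 1 1 (φ w) := by
  have hcoords := h'.differentiableAt_coords hφw
  have hF := h.complexVel_dotProduct hw (-I) I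
  have hG := h'.complexVel_dotProduct hφw (-I) I
  rw [complexVel_neg_I_comp hcoords hφ hFG, complexVel_I_comp hcoords hφ hFG, smul_dotProduct,
    dotProduct_smul, hG, neg_mul, Complex.I_mul_I, smul_eq_mul, smul_eq_mul] at hF
  linear_combination -2 * hF

theorem complexNormal_comp (h : IsConformalImmersionOn F U) (h' : IsConformalImmersionOn G V)
    (hw : w ∈ U) (hφw : φ w ∈ V) (hφ : DifferentiableAt ℂ φ w)
    (hFG : F =ᶠ[𝓝 w] fun u => G (φ u)) :
    complexNormal F w = complexNormal G (φ w) := by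
  have hcoords := h'.differentiableAt_coords hφw
  have hcross := h.complexVel_cross hw (-I) I
  rw [complexVel_neg_I_comp hcoords hφ hFG, complexVel_I_comp hcoords hφ hFG, map_smul, map_smul,
    LinearMap.smul_apply, h'.complexVel_cross hφw, smul_smul, smul_smul] at hcross
  have hne : (I - -I) / 4 * (firstForm F 1 1 w : ℂ) ≠ 0 := by
    simp [h.ofReal_firstForm_ne_zero hw, Complex.I_ne_zero]
  refine smul_right_injective _ hne (hcross.symm.trans ?_)
  simp only [h.firstForm_comp h' hw hφw hφ hFG]
  congr 1
  ring

theorem complexCovDeriv_I_complexVel_neg_I_comp (h : IsConformalImmersionOn F U)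
    (h' : IsConformalImmersionOn G V) (hφ : DifferentiableOn ℂ φ U) (hmaps : Set.MapsTo φ U V)
    (hFG : ∀ u ∈ U, F =ᶠ[𝓝 u] fun t => G (φ t)) (hw : w ∈ U) :
    ∇[F, I] (complexVel F (-I)) w =
      (deriv φ w * (starRingEnd ℂ) (deriv φ w)) • ∇[G, I] (complexVel G (-I)) (φ w) := by
  have hU {u : ℂ} (hu : u ∈ U) : U ∈ 𝓝 u := h.isOpen.mem_nhds hu
  have hG := h'.differentiableAt_coords (hmaps hw)
  have hZ := (h'.contDiffAt_complexVel (hmaps hw) (-I)).differentiableAt (by simp)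
  have hφw := hφ.differentiableAt (hU hw)
  have hZφ : DifferentiableAt ℝ (fun u => complexVel G (-I) (φ u)) w :=
    DifferentiableAt.comp w hZ (hφw.restrictScalars ℝ)
  have hdφ : DifferentiableAt ℂ (deriv φ) w := (hφ.analyticAt (hU hw)).deriv.differentiableAt
  have hvel : complexVel F (-I) =ᶠ[𝓝 w] fun u => deriv φ u • complexVel G (-I) (φ u) := by
    filter_upwards [hU hw] with u hu
    exact complexVel_neg_I_comp (h'.differentiableAt_coords (hmaps hu))
      (hφ.differentiableAt (hU hu)) (hFG u hu)
  rw [complexCovDeriv_congr hvel, complexCovDeriv_smul (hdφ.restrictScalars ℝ) hZφ,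
    wirtingerOp_I_eq_zero hdφ, zero_smul, zero_add,
    complexCovDeriv_comp hG hφw (hFG w hw) Complex.I_mul_I hZ, smul_smul]
  congr 2
  simp [Complex.ext_iff]

theorem meanCurv_comp (h : IsConformalImmersionOn F U) (h' : IsConformalImmersionOn G V)
    (hφ : DifferentiableOn ℂ φ U) (hmaps : Set.MapsTo φ U V) (hFG : ∀ u ∈ U, F u = G (φ u))
    (hw : w ∈ U) : meanCurv F w = meanCurv G (φ w) := by
  have hFG' : ∀ u ∈ U, F =ᶠ[𝓝 u] fun t => G (φ t) := fun u hu =>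
    Filter.eventually_of_mem (h.isOpen.mem_nhds hu) hFG
  have hφw := hφ.differentiableAt (h.isOpen.mem_nhds hw)
  have hDF := h.complexCovDeriv_I_dotProduct_complexNormal hw
  rw [h.complexCovDeriv_I_complexVel_neg_I_comp h' hφ hmaps hFG' hw,
    h.complexNormal_comp h' hw (hmaps hw) hφw (hFG' w hw), smul_dotProduct,
    h'.complexCovDeriv_I_dotProduct_complexNormal (hmaps hw), smul_eq_mul] at hDF
  refine Complex.ofReal_injective (mul_left_cancel₀ (h.ofReal_firstForm_ne_zero hw) ?_)
  linear_combination -2 * hDF -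
    meanCurv G (φ w) * h.firstForm_comp h' hw (hmaps hw) hφw (hFG' w hw)

end IsConformalImmersionOn

section Surface

variable {M : Type*} [TopologicalSpace M] [ChartedSpace ℂ M] [IsManifold 𝓘(ℂ, ℂ) ω M]

theorem contDiffOn_transition {e e' : OpenPartialHomeomorph M ℂ} (he : e ∈ atlas ℂ M)
    (he' : e' ∈ atlas ℂ M) : ContDiffOn ℂ ω (e.symm ≫ₕ e') (e.symm ≫ₕ e').source :=
  contMDiffOn_iff_contDiffOn.mp (contMDiffOn_of_mem_contDiffGroupoid
    (HasGroupoid.compatible (G := contDiffGroupoid ω 𝓘(ℂ, ℂ)) he he'))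

theorem isManifold_real : IsManifold 𝓘(ℝ, ℂ) ∞ M := by
  refine isManifold_of_contDiffOn _ _ _ fun e e' he he' => ?_
  simpa using ((contDiffOn_transition he he').restrict_scalars ℝ).of_le (m := ∞) (by simp)

namespace IsConformalImmersion

variable {f : M → Nil} {e e' : OpenPartialHomeomorph M ℂ}

theorem isConformalImmersionOn (hf : IsConformalImmersion f) (he : e ∈ atlas ℂ M) :
    IsConformalImmersionOn (inChart f e) e.target := by
  have : IsManifold 𝓘(ℝ, ℂ) ∞ M := isManifold_real
  refine ⟨e.open_target, contMDiffOn_iff_contDiffOn.mp ?_, hf.pos e he, hf.eq e he,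
    hf.orthogonal e he⟩
  exact hf.smooth.comp_contMDiffOn
    (contMDiffOn_symm_of_mem_maximalAtlas (IsManifold.subset_maximalAtlas he))

theorem meanCurv_inChart_eq (hf : IsConformalImmersion f) (he : e ∈ atlas ℂ M)
    (he' : e' ∈ atlas ℂ M) {p : M} (hp : p ∈ e.source) (hp' : p ∈ e'.source) :
    meanCurv (inChart f e) (e p) = meanCurv (inChart f e') (e' p) := by
  have hsub : (e.symm ≫ₕ e').source ⊆ e.target := by
    simp only [OpenPartialHomeomorph.trans_source, OpenPartialHomeomorph.symm_source,
      Set.inter_subset_left]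
  have hmaps : Set.MapsTo (e.symm ≫ₕ e') (e.symm ≫ₕ e').source e'.target := fun u hu =>
    e'.map_source (by simp_all)
  have hfactor (u : ℂ) (hu : u ∈ (e.symm ≫ₕ e').source) :
      inChart f e u = inChart f e' ((e.symm ≫ₕ e') u) := by
    have hu' : e.symm u ∈ e'.source := by simp_all
    simp [inChart, e'.left_inv hu']
  have hcomp := ((hf.isConformalImmersionOn he).mono
    (e.symm ≫ₕ e').open_source hsub).meanCurv_comp (w := e p) (hf.isConformalImmersionOn he')
    ((contDiffOn_transition he he').differentiableOn (by simp)) hmaps hfactor (by simp [hp, hp'])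
  simpa [hp] using hcomp

end IsConformalImmersion

theorem isLocallyConstant_meanCurvature {f : M → Nil} (hf : IsConformalImmersion f)
    (hol : ModifiedHopfHolomorphic f) : IsLocallyConstant (meanCurvature f) := by
  rw [IsLocallyConstant.iff_eventually_eq]
  intro p
  have he := chart_mem_atlas ℂ p
  have hp := mem_chart_source ℂ p
  have h := hf.isConformalImmersionOn he
  obtain ⟨r, hr, hball⟩ := Metric.isOpen_iff.mp h.isOpen _ (mem_chart_target ℂ p)
  have hconst : ∀ u ∈ Metric.ball (chartAt ℂ p p) r,
      meanCurv (inChart f (chartAt ℂ p)) u = meanCurvature f p := fun u hu =>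
    Metric.isOpen_ball.is_const_of_fderiv_eq_zero (𝕜 := ℝ) (convex_ball _ _).isPreconnected
      (fun v hv => ((h.contDiffAt_meanCurv (hball hv)).differentiableAt
        (by simp)).differentiableWithinAt)
      (fun v hv => h.fderiv_meanCurv_eq_zero (hol _ he) (hball hv)) hu (Metric.mem_ball_self hr)
  filter_upwards [(chartAt ℂ p).open_source.mem_nhds hp,
    ((chartAt ℂ p).continuousAt hp).preimage_mem_nhds (Metric.ball_mem_nhds _ hr)] with q hq hqr
  exact (hf.meanCurv_inChart_eq (chart_mem_atlas ℂ q) he (mem_chart_source ℂ q) hq).trans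
    (hconst _ hqr)

end Surface

end

end NilGeometry

theorem mainTheorem6 {M : Type*} [TopologicalSpace M] [ConnectedSpace M] [ChartedSpace ℂ M]
    [IsManifold 𝓘(ℂ, ℂ) ω M] (f : M → NilGeometry.Nil)
    (hf : NilGeometry.IsConformalImmersion f)
    (hol : NilGeometry.ModifiedHopfHolomorphic f) :
    ∃ c : ℝ, ∀ p : M, NilGeometry.meanCurvature f p = c := by
  obtain ⟨c, hc⟩ := (NilGeometry.isLocallyConstant_meanCurvature hf hol).exists_eq_const
  exact ⟨c, fun p => congrFun hc p⟩
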